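/- Let $n,k\in\mathbb N$, let $R=\mathbb R[x_1,\dots,x_n]$ and let $R_d\subset R$ be the space of polynomials of total degree at most $d$. Let $A\subset\mathbb N^n$ be finite, let $V$ be the span of the monomials $\mathbf x^\alpha$ with $\alpha\in A$, let $\deg V$ be the largest total degree of an element of $V$ (with $\deg 0=0$), and let $\mathbf i=(\mathbf i_\alpha)_{\alpha\in A}$ be a family of real numbers (for example the moments $\mathbf i_\alpha=I[\mathbf x^\alpha]$ of an integral $I$). For a linear form $\sigma\in R_{2k}^*$ let $H_\sigma$ be the truncated Hankel operator on $R_k$, i.e. the bilinear form $H_\sigma(p,q)=\sigma(pq)$ on $R_k\times R_k$, and put $$\mathcal H^k(\mathbf i)=\{H_\sigma : \sigma\in R_{2k}^*,\ \sigma(\mathbf x^\alpha)=\mathbf i_\alpha \text{ for all }\alpha\in A,\ H_\sigma\succcurlyeq 0\}.$$ This is a convex set. For $r\in\mathbb N$ let $\mathcal E^k_r(\mathbf i)$ be the set of those $H_\sigma\in\mathcal H^k(\mathbf i)$ for which there are pairwise distinct points $\zeta_1,\dots,\zeta_r\in\mathbb R^n$ and weights $w_1,\dots,w_r>0$ with $\sigma(p)=\sum_{j=1}^r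 w_j\,p(\zeta_j)$ for all $p\in R_{2k}$. A face of a convex set $C$ is a convex subset $F\subseteq C$ such that $x,y\in F$ whenever $x,y\in C$ and some point of the open segment between $x$ and $y$ lies in $F$. Proposition. Let $k\ge\frac{\deg V+1}{2}$, and let $H\in\mathcal H^k(\mathbf i)$ be an element whose rank $r$ is minimal among the ranks of the elements of $\mathcal H^k(\mathbf i)$. If $r\le k$, then $H\in\mathcal E^k_r(\mathbf i)$, and either $H$ is an extreme point of $\mathcal H^k(\mathbf i)$, or $H$ lies on a face of $\mathcal H^k(\mathbf i)$ that is contained in $\mathcal E^k_r(\mathbf i)$. -/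

import Mathlib

namespace Cubature

noncomputable section

/-- The space `R_d` of real polynomials in `n` variables of total degree at most `d`. -/
abbrev polyLE (n d : ℕ) : Submodule ℝ (MvPolynomial (Fin n) ℝ) :=
  MvPolynomial.restrictTotalDegree (Fin n) ℝ d

/-- The space `V` spanned by the monomials `x ^ α`, `α ∈ A`. -/
def monomialSpace {n : ℕ} (A : Finset (Fin n →₀ ℕ)) : Submodule ℝ (MvPolynomial (Fin n) ℝ) :=
  Submodule.span ℝ ((fun α => MvPolynomial.monomial α (1 : ℝ)) '' (A : Set (Fin n →₀ ℕ)))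

/-- The degree of a (finite dimensional) space of polynomials: the largest total degree of its
elements (the zero polynomial counts as having degree `0`). -/
def spaceDegree {n : ℕ} (V : Submodule ℝ (MvPolynomial (Fin n) ℝ)) : ℕ :=
  sSup (MvPolynomial.totalDegree '' (V : Set (MvPolynomial (Fin n) ℝ)))

/-- For a space spanned by finitely many monomials the supremum is a maximum. -/
theorem isGreatest_spaceDegree {n : ℕ} (A : Finset (Fin n →₀ ℕ)) :
    IsGreatest (MvPolynomial.totalDegree '' (monomialSpace A : Set (MvPolynomial (Fin n) ℝ)))
      (spaceDegree (monomialSpace A)) := by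
  have hne : (MvPolynomial.totalDegree ''
      (monomialSpace A : Set (MvPolynomial (Fin n) ℝ))).Nonempty :=
    ⟨_, 0, Submodule.zero_mem _, rfl⟩
  have hle : monomialSpace A ≤ polyLE n (A.sup fun α => α.sum fun _ e => e) := by
    refine Submodule.span_le.2 ?_
    rintro _ ⟨α, hα, rfl⟩
    refine (MvPolynomial.mem_restrictTotalDegree _ _ _).2 ?_
    rw [MvPolynomial.totalDegree_monomial _ one_ne_zero]
    exact Finset.le_sup (f := fun α : Fin n →₀ ℕ => α.sum fun _ e => e) hα
  have hbdd : BddAbove (MvPolynomial.totalDegree ''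
      (monomialSpace A : Set (MvPolynomial (Fin n) ℝ))) := by
    refine ⟨A.sup fun α => α.sum fun _ e => e, ?_⟩
    rintro _ ⟨p, hp, rfl⟩
    exact (MvPolynomial.mem_restrictTotalDegree _ _ _).1 (hle hp)
  exact ⟨Nat.sSup_mem hne hbdd, fun d hd => le_csSup hbdd hd⟩

theorem mul_mem_polyLE {n k : ℕ} (p q : polyLE n k) :
    (p : MvPolynomial (Fin n) ℝ) * q ∈ polyLE n (2 * k) := by
  rw [MvPolynomial.mem_restrictTotalDegree]
  have hp := (MvPolynomial.mem_restrictTotalDegree _ _ _).1 p.2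
  have hq := (MvPolynomial.mem_restrictTotalDegree _ _ _).1 q.2
  have := MvPolynomial.totalDegree_mul (p : MvPolynomial (Fin n) ℝ) q
  omega

/-- The truncated Hankel operator `H_σ` on `R_k` of a linear form `σ` on `R_{2k}`, as the bilinear
form `(p, q) ↦ σ (p q)`, i.e. as the linear map `R_k → R_k^*`, `p ↦ (q ↦ σ (p q))`. -/
def hankel {n k : ℕ} (σ : Module.Dual ℝ (polyLE n (2 * k))) :
    LinearMap.BilinForm ℝ (polyLE n k) :=
  LinearMap.mk₂ ℝ (fun p q => σ ⟨(p : MvPolynomial (Fin n) ℝ) * q, mul_mem_polyLE p q⟩)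
    (fun p p' q => by rw [← map_add]; congr 1; ext1; simp [add_mul])
    (fun c p q => by rw [← map_smul]; congr 1; ext1; simp)
    (fun p q q' => by rw [← map_add]; congr 1; ext1; simp [mul_add])
    (fun c p q => by rw [← map_smul]; congr 1; ext1; simp)

/-- The rank of a truncated Hankel operator (`R_k` is finite dimensional). -/
def hankelRank {n k : ℕ} (H : LinearMap.BilinForm ℝ (polyLE n k)) : ℕ :=
  Module.finrank ℝ (LinearMap.range H)

/-- `σ` is a linear form on `R_{2k}` whose moments extend the sequence `i`: `A` consists of
exponents of degree at most `2k` and `σ (x ^ α) = i α` for `α ∈ A`. -/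
def Extends {n k : ℕ} {A : Finset (Fin n →₀ ℕ)} (σ : Module.Dual ℝ (polyLE n (2 * k)))
    (i : A → ℝ) : Prop :=
  ∀ α : A, ∃ h : MvPolynomial.monomial (α : Fin n →₀ ℕ) (1 : ℝ) ∈ polyLE n (2 * k),
    σ ⟨_, h⟩ = i α

/-- The set `ℋ^k(i)` of positive semidefinite truncated Hankel operators on `R_k` associated to
the linear forms on `R_{2k}` that extend `i`. -/
def hankelSet {n : ℕ} (k : ℕ) {A : Finset (Fin n →₀ ℕ)} (i : A → ℝ) :
    Set (LinearMap.BilinForm ℝ (polyLE n k)) :=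
  {H | ∃ σ : Module.Dual ℝ (polyLE n (2 * k)), H = hankel σ ∧ Extends σ i ∧ H.IsPosSemidef}

/-- `σ = ∑ j, w j • e_{ζ j}` on `R_{2k}`, with `r` positive weights and `r` distinct real points. -/
def IsPositiveCubature {n k : ℕ} (r : ℕ) (σ : Module.Dual ℝ (polyLE n (2 * k))) : Prop :=
  ∃ (w : Fin r → ℝ) (ζ : Fin r → (Fin n → ℝ)), (∀ j, 0 < w j) ∧ Function.Injective ζ ∧
    ∀ p : polyLE n (2 * k), σ p = ∑ j, w j * MvPolynomial.eval (ζ j) (p : MvPolynomial (Fin n) ℝ)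

/-- The set `ℰ^k_r(i)` of the elements of `ℋ^k(i)` that come from cubature formulae with `r`
points and positive weights. -/
def cubatureSet {n : ℕ} (k r : ℕ) {A : Finset (Fin n →₀ ℕ)} (i : A → ℝ) :
    Set (LinearMap.BilinForm ℝ (polyLE n k)) :=
  {H | H ∈ hankelSet k i ∧
    ∃ σ : Module.Dual ℝ (polyLE n (2 * k)), H = hankel σ ∧ IsPositiveCubature r σ}

/-- A face of a convex set `C`: a convex subset `F` such that every closed segment contained
in `C` that has an interior point in `F` lies in `F`. -/
def IsFace {E : Type*} [AddCommGroup E] [Module ℝ E] (C F : Set E) : Prop :=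
  Convex ℝ F ∧ IsExtreme ℝ C F

end

end Cubature

namespace Cubature

open MvPolynomial

/-! Filter `R_k` by the spaces `polyLT n d ⊔ hankelKer L k`. There are `k + 1` steps but the total
dimension increase is only `r ≤ k`, so some step stagnates (`exists_le_polyLE_le`). As the kernel is
stable under variables in low degree, stagnation propagates up to degree `k - 1`. The truncation to
that degree is then flat, and flat extension (`exists_cubature_of_flat`) gives a positive cubature
agreeing with `L` up to degree `2k - 1 ≥ deg V`. If `H` itself were not flat, this cubature would
have fewer than `r` nodes and would produce an element of `ℋ^k(i)` of smaller rank. So `H` is flat,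
and flat extension applied to `H` yields exactly `r` nodes. For the face, take the elements of
`ℋ^k(i)` whose kernel contains `ker H`. Their rank is at most `r`, hence minimal, so the first part
applies to each of them. -/

/-! ### Degree filtration -/

theorem monomial_mem_polyLE {n d : ℕ} {α : Fin n →₀ ℕ} (c : ℝ) (h : α.degree ≤ d) :
    monomial α c ∈ polyLE n d :=
  (monomial_mem_restrictSupport ℝ).2 (Or.inl h)

theorem polyLE_mono {n d e : ℕ} (h : d ≤ e) : polyLE n d ≤ polyLE n e := fun _ hp =>
  (mem_restrictTotalDegree _ _ _).2 (((mem_restrictTotalDegree _ _ _).1 hp).trans h)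

theorem mul_mem_polyLE_add {n d e : ℕ} {p q : MvPolynomial (Fin n) ℝ} (hp : p ∈ polyLE n d)
    (hq : q ∈ polyLE n e) : p * q ∈ polyLE n (d + e) := by
  rw [mem_restrictTotalDegree] at *
  exact (totalDegree_mul p q).trans (add_le_add hp hq)

theorem X_mem_polyLE {n : ℕ} (i : Fin n) : (X i : MvPolynomial (Fin n) ℝ) ∈ polyLE n 1 :=
  (mem_restrictTotalDegree _ _ _).2 (totalDegree_X i).le

theorem X_mul_mem_polyLE {n d : ℕ} (i : Fin n) {q : MvPolynomial (Fin n) ℝ}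
    (hq : q ∈ polyLE n d) : X i * q ∈ polyLE n (d + 1) :=
  add_comm 1 d ▸ mul_mem_polyLE_add (X_mem_polyLE i) hq

theorem one_mem_polyLE {n : ℕ} (d : ℕ) : (1 : MvPolynomial (Fin n) ℝ) ∈ polyLE n d :=
  (mem_restrictTotalDegree _ _ _).2 (by simp)

theorem polyLE_zero_le {n : ℕ} {N : Submodule ℝ (MvPolynomial (Fin n) ℝ)} (h : 1 ∈ N) :
    polyLE n 0 ≤ N := by
  intro p hp
  have hp : p.totalDegree = 0 := Nat.le_zero.1 ((mem_restrictTotalDegree _ _ _).1 hp)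
  rw [totalDegree_eq_zero_iff_eq_C.1 hp, ← mul_one (C _), ← smul_eq_C_mul]
  exact N.smul_mem _ h

theorem polyLE_succ_le {n d : ℕ} {N : Submodule ℝ (MvPolynomial (Fin n) ℝ)}
    (h : polyLE n d ≤ N) (hX : ∀ i, ∀ q ∈ polyLE n d, X i * q ∈ N) : polyLE n (d + 1) ≤ N := by
  rw [polyLE, restrictTotalDegree, restrictSupport_eq_span, Submodule.span_le]
  rintro _ ⟨α, hα, rfl⟩
  change α.degree ≤ d + 1 at hα
  rcases eq_or_ne α 0 with rfl | h0
  · exact h (one_mem_polyLE d)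
  · obtain ⟨i, hi⟩ := Finsupp.ne_iff.1 h0
    have hs : Finsupp.single i 1 + (α - Finsupp.single i 1) = α :=
      add_tsub_cancel_of_le (Finsupp.single_le_iff.2 (Nat.one_le_iff_ne_zero.2 hi))
    have hd := congrArg Finsupp.degree hs
    rw [map_add, Finsupp.degree_single] at hd
    have := hX i (monomial (α - Finsupp.single i 1) 1)
      (monomial_mem_polyLE 1 (by omega))
    rwa [X, monomial_mul, hs, one_mul] at this

/-- Reduces identities between linear forms on `R_{d+e}` to products, where kernel elements can be
used on either factor. -/
theorem polyLE_add_le_mul {n : ℕ} (d e : ℕ) : polyLE n (d + e) ≤ polyLE n d * polyLE n e := by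
  induction e with
  | zero =>
    intro p hp
    exact mul_one p ▸ Submodule.mul_mem_mul hp (one_mem_polyLE 0)
  | succ e ih =>
    refine polyLE_succ_le (ih.trans (mul_le_mul' le_rfl (polyLE_mono e.le_succ))) ?_
    intro i q hq
    refine Submodule.mul_induction_on (ih hq) (fun a ha b hb => ?_) fun a b ha hb => ?_
    · rw [mul_left_comm]
      exact Submodule.mul_mem_mul ha (X_mul_mem_polyLE i hb)
    · rw [mul_add]
      exact add_mem ha hb

/-- The polynomials of total degree less than `d`. -/
noncomputable def polyLT (n : ℕ) : ℕ → Submodule ℝ (MvPolynomial (Fin n) ℝ)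
  | 0 => ⊥
  | d + 1 => polyLE n d

theorem polyLT_le_polyLE {n : ℕ} (d : ℕ) : polyLT n d ≤ polyLE n d := by
  cases d with
  | zero => exact bot_le
  | succ d => exact polyLE_mono d.le_succ

theorem polyLT_mono {n : ℕ} : Monotone (polyLT n) :=
  monotone_nat_of_le_succ polyLT_le_polyLE

theorem X_mul_mem_of_mem_polyLT {n d : ℕ} (i : Fin n) {q : MvPolynomial (Fin n) ℝ}
    (hq : q ∈ polyLT n d) : X i * q ∈ polyLE n d := by
  cases d with
  | zero => rw [(Submodule.mem_bot ℝ).1 hq, mul_zero]; exact zero_mem _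
  | succ d => exact X_mul_mem_polyLE i hq

/-! ### Kernels of truncated Hankel forms -/

/-- `L` is nonnegative on squares of polynomials of degree at most `m`. -/
def NonnegOnSquares {n : ℕ} (L : MvPolynomial (Fin n) ℝ →ₗ[ℝ] ℝ) (m : ℕ) : Prop :=
  ∀ p ∈ polyLE n m, 0 ≤ L (p * p)

/-- The kernel of the truncated Hankel operator of `L` on polynomials of degree at most `m`. -/
def hankelKer {n : ℕ} (L : MvPolynomial (Fin n) ℝ →ₗ[ℝ] ℝ) (m : ℕ) :
    Submodule ℝ (MvPolynomial (Fin n) ℝ) where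
  carrier := {p | p ∈ polyLE n m ∧ ∀ q ∈ polyLE n m, L (p * q) = 0}
  add_mem' ha hb := ⟨add_mem ha.1 hb.1, fun q hq => by
    rw [add_mul, map_add, ha.2 q hq, hb.2 q hq, add_zero]⟩
  zero_mem' := ⟨zero_mem _, fun q _ => by rw [zero_mul, map_zero]⟩
  smul_mem' c a ha := ⟨Submodule.smul_mem _ c ha.1, fun q hq => by
    rw [smul_mul_assoc, map_smul, ha.2 q hq, smul_zero]⟩

section Kernel

variable {n : ℕ} {L : MvPolynomial (Fin n) ℝ →ₗ[ℝ] ℝ}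

theorem NonnegOnSquares.mono {d m : ℕ} (h : NonnegOnSquares L m) (hd : d ≤ m) :
    NonnegOnSquares L d := fun p hp => h p (polyLE_mono hd hp)

theorem hankelKer_le (m : ℕ) : hankelKer L m ≤ polyLE n m := fun _ h => h.1

/-- The Cauchy–Schwarz argument: an isotropic vector of a positive semidefinite form lies in its
radical. -/
theorem NonnegOnSquares.mem_hankelKer {m : ℕ} (h : NonnegOnSquares L m)
    {p : MvPolynomial (Fin n) ℝ} (hp : p ∈ polyLE n m) (h0 : L (p * p) = 0) :
    p ∈ hankelKer L m := by
  refine ⟨hp, fun q hq => ?_⟩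
  have ha := h q hq
  -- The minimizer would be `-b / a`; the shift to `a + 1` covers `a = 0` and still gives the
  -- negative value `-b²(a + 2)/(a + 1)²` unless `b = 0`.
  have hb := h ((-L (p * q) / (L (q * q) + 1)) • q + p)
    (add_mem (Submodule.smul_mem _ _ hq) hp)
  have hexp : ∀ t : ℝ, L ((t • q + p) * (t • q + p)) = t * t * L (q * q) + 2 * t * L (p * q) := by
    intro t
    rw [show (t • q + p) * (t • q + p) = (t * t) • (q * q) + (2 * t) • (p * q) + p * p by
      simp only [smul_eq_C_mul, map_mul, map_ofNat]; ring]
    simp [h0]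
  rw [hexp] at hb
  set a := L (q * q)
  set b := L (p * q)
  have hpos : 0 < a + 1 := by linarith
  have hE : -b / (a + 1) * (-b / (a + 1)) * a + 2 * (-b / (a + 1)) * b
      = -(b ^ 2 * (a + 2)) / (a + 1) ^ 2 := by field_simp; ring
  rw [hE, neg_div, Left.nonneg_neg_iff, div_le_iff₀ (by positivity), zero_mul] at hb
  have : b ^ 2 * (a + 2) = 0 := le_antisymm hb (by positivity)
  rcases mul_eq_zero.1 this with h | h
  · exact pow_eq_zero_iff two_ne_zero |>.1 h
  · linarith

theorem NonnegOnSquares.hankelKer_mono {d m : ℕ} (h : NonnegOnSquares L m) (hd : d ≤ m) :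
    hankelKer L d ≤ hankelKer L m := fun p hp =>
  h.mem_hankelKer (polyLE_mono hd hp.1) (hp.2 p hp.1)

theorem hankelKer_inf_polyLE {d m : ℕ} (h : NonnegOnSquares L m) (hd : d ≤ m) :
    hankelKer L m ⊓ polyLE n d = hankelKer L d :=
  le_antisymm (fun _ hp => ⟨hp.2, fun q hq => hp.1.2 q (polyLE_mono hd hq)⟩)
    (le_inf (h.hankelKer_mono hd) (hankelKer_le d))

/-- The kernel is stable under multiplication by a variable, in degrees less than `m`. -/
theorem X_mul_mem_hankelKer_of_lt {d m : ℕ} (h : NonnegOnSquares L m) (hd : d + 2 ≤ m)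
    {p : MvPolynomial (Fin n) ℝ} (hp : p ∈ hankelKer L m) (hpd : p ∈ polyLE n d) (i : Fin n) :
    X i * p ∈ hankelKer L m := by
  have h1 := X_mul_mem_polyLE i hpd
  refine h.mem_hankelKer (polyLE_mono (by omega) h1) ?_
  -- Both variables move to one factor, whose degree `d + 2` is still at most `m`.
  rw [show X i * p * (X i * p) = p * (X i * (X i * p)) by ring]
  exact hp.2 _ (polyLE_mono (by omega) (X_mul_mem_polyLE i h1))

/-- If the Hankel operator is flat, then the kernel is stable under multiplication by a variable,
as far as degrees allow. -/
theorem X_mul_mem_hankelKer_of_flat {m : ℕ}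
    (hflat : polyLE n m ≤ polyLT n m ⊔ hankelKer L m)
    {p : MvPolynomial (Fin n) ℝ} (hp : p ∈ hankelKer L m) (hpd : p ∈ polyLT n m) (i : Fin n) :
    X i * p ∈ hankelKer L m := by
  have h1 := X_mul_mem_of_mem_polyLT i hpd
  refine ⟨h1, fun q hq => ?_⟩
  obtain ⟨q₀, hq₀, κ, hκ, rfl⟩ := Submodule.mem_sup.1 (hflat hq)
  rw [mul_add, map_add, show X i * p * q₀ = p * (X i * q₀) by ring,
    hp.2 _ (X_mul_mem_of_mem_polyLT i hq₀), mul_comm (X i * p), hκ.2 _ h1, add_zero]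

theorem polyLT_flat_succ {d m : ℕ} (h : NonnegOnSquares L m) (hd : d + 2 ≤ m)
    (hf : polyLE n d ≤ polyLT n d ⊔ hankelKer L m) :
    polyLE n (d + 1) ≤ polyLE n d ⊔ hankelKer L m := by
  refine polyLE_succ_le le_sup_left fun i q hq => ?_
  obtain ⟨q₀, hq₀, κ, hκ, rfl⟩ := Submodule.mem_sup.1 (hf hq)
  rw [mul_add]
  refine Submodule.add_mem_sup (X_mul_mem_of_mem_polyLT i hq₀)
    (X_mul_mem_hankelKer_of_lt h hd hκ ?_ i)
  simpa using sub_mem hq (polyLT_le_polyLE d hq₀)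

end Kernel

/-! ### Joint eigenvectors and flat extension -/

/-- Simultaneous diagonalization of commuting operators that are symmetric with respect to a
positive definite form, as a decomposition of vectors. -/
theorem exists_sum_joint_eigenvectors {ι B : Type*} [AddCommGroup B] [Module ℝ B]
    [FiniteDimensional ℝ B] (β : LinearMap.BilinForm ℝ B) (hβ : ∀ x y, β x y = β y x)
    (hpos : ∀ x, x ≠ 0 → 0 < β x x) (T : ι → B →ₗ[ℝ] B)
    (hT : ∀ i x y, β (T i x) y = β x (T i y)) (hcomm : ∀ i j, Commute (T i) (T j)) (x : B) :
    ∃ (S : Finset (ι → ℝ)) (u : (ι → ℝ) → B), x = ∑ χ ∈ S, u χ ∧ (∀ χ ∈ S, u χ ≠ 0) ∧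
      (∀ χ i, T i (u χ) = χ i • u χ) ∧ ∀ χ χ', χ ≠ χ' → β (u χ) (u χ') = 0 := by
  let core : InnerProductSpace.Core ℝ B :=
    { inner := fun x y => β x y
      conj_inner_symm := fun x y => hβ y x
      re_inner_nonneg := fun x => by
        rcases eq_or_ne x 0 with rfl | hx
        · simp
        · exact (hpos x hx).le
      add_left := fun x y z => by simp
      smul_left := fun x y r => by simp
      definite := fun x hx => by
        by_contra h
        exact (hpos x h).ne' hx }
  let : NormedAddCommGroup B := core.toNormedAddCommGroup
  let : InnerProductSpace ℝ B := InnerProductSpace.ofCore core.toCore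
  have htop := LinearMap.IsSymmetric.iSup_iInf_eq_top_of_commute (𝕜 := ℝ) (T := T)
    (fun i x y => hT i x y) (fun i j _ => hcomm i j)
  obtain ⟨u, hu, hx⟩ := (Submodule.mem_iSup_iff_exists_finsupp _ _).1
    (htop.symm ▸ Submodule.mem_top (x := x))
  have hu' : ∀ χ i, T i (u χ) = χ i • u χ := fun χ i =>
    Module.End.mem_eigenspace_iff.1 ((Submodule.mem_iInf _).1 (hu χ) i)
  refine ⟨u.support, u, hx.symm, fun χ h => Finsupp.mem_support_iff.1 h, hu', ?_⟩
  intro χ χ' hne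
  obtain ⟨i, hi⟩ := Function.ne_iff.1 hne
  have := hT i (u χ) (u χ')
  rw [hu', hu', map_smul, map_smul, LinearMap.smul_apply, smul_eq_mul, smul_eq_mul] at this
  have := sub_eq_zero.2 this
  rw [← sub_mul] at this
  exact (mul_eq_zero.1 this).resolve_left (sub_ne_zero.2 hi)

section Flat

variable {n : ℕ} {L : MvPolynomial (Fin n) ℝ →ₗ[ℝ] ℝ}

instance (m : ℕ) : FiniteDimensional ℝ (hankelKer L m) :=
  Submodule.finiteDimensional_of_le (hankelKer_le m)

/-- A flat Hankel operator admits a complement of its kernel consisting of polynomials of degree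
less than `m`, with the corresponding projection. -/
theorem exists_projection_of_flat {m : ℕ}
    (hflat : polyLE n m ≤ polyLT n m ⊔ hankelKer L m) :
    ∃ (B : Submodule ℝ (MvPolynomial (Fin n) ℝ)) (π : MvPolynomial (Fin n) ℝ →ₗ[ℝ] B),
      B ≤ polyLT n m ∧ B ⊓ hankelKer L m = ⊥ ∧ B ⊔ hankelKer L m = polyLE n m ∧
      (∀ b : B, π b = b) ∧ (∀ p ∈ hankelKer L m, π p = 0) ∧
      ∀ p ∈ polyLE n m, p - π p ∈ hankelKer L m := by
  obtain ⟨C, hC⟩ := Submodule.exists_isCompl (hankelKer L m ⊓ polyLT n m)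
  have hbot : (C ⊓ polyLT n m) ⊓ hankelKer L m = ⊥ := by
    rw [inf_assoc, inf_comm (polyLT n m), inf_comm, hC.inf_eq_bot]
  -- Modular law: cutting the complement `C` by `polyLT n m` leaves a complement of the kernel part
  -- inside `polyLT n m`.
  have hW : (hankelKer L m ⊓ polyLT n m) ⊔ (C ⊓ polyLT n m) = polyLT n m := by
    rw [← sup_inf_assoc_of_le C inf_le_right, hC.sup_eq_top, top_inf_eq]
  have hsup : (C ⊓ polyLT n m) ⊔ hankelKer L m = polyLE n m := by
    refine le_antisymm (sup_le (inf_le_right.trans (polyLT_le_polyLE m)) (hankelKer_le m))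
      (hflat.trans (sup_le ?_ le_sup_right))
    conv_lhs => rw [← hW]
    exact sup_le (inf_le_left.trans le_sup_right) le_sup_left
  generalize hB : C ⊓ polyLT n m = B at hbot hsup
  obtain ⟨K', hK', hcompl⟩ := (disjoint_iff.2 (inf_comm B _ ▸ hbot)).exists_isCompl
  have hker : ∀ p ∈ hankelKer L m, B.projectionOnto K' hcompl.symm p = 0 := fun p hp =>
    Submodule.projectionOnto_apply_right hcompl.symm ⟨p, hK' hp⟩
  refine ⟨B, B.projectionOnto K' hcompl.symm, hB ▸ inf_le_right, hbot, hsup,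
    fun b => Submodule.projectionOnto_apply_left hcompl.symm b, hker, fun p hp => ?_⟩
  obtain ⟨b, hb, κ, hκ, rfl⟩ := Submodule.mem_sup.1 (hsup.ge hp)
  have := Submodule.projectionOnto_apply_left hcompl.symm ⟨b, hb⟩
  rw [map_add, hker κ hκ, add_zero, this]
  simpa using hκ

/-- The flat extension theorem for positive semidefinite Hankel operators. -/
theorem exists_cubature_of_flat {m : ℕ} (h : NonnegOnSquares L m)
    (hflat : polyLE n m ≤ polyLT n m ⊔ hankelKer L m) :
    ∃ (S : Finset (Fin n → ℝ)) (w : (Fin n → ℝ) → ℝ), (∀ ζ ∈ S, 0 < w ζ) ∧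
      (∀ p ∈ polyLE n (2 * m), L p = ∑ ζ ∈ S, w ζ * eval ζ p) ∧
      S.card + Module.finrank ℝ (hankelKer L m) = Module.finrank ℝ (polyLE n m) := by
  obtain ⟨B, π, hBlt, hbot, hsup, hπB, hπK, hπ⟩ := exists_projection_of_flat hflat
  have hBle : B ≤ polyLE n m := hBlt.trans (polyLT_le_polyLE m)
  have : FiniteDimensional ℝ B := Submodule.finiteDimensional_of_le hBle
  have hL : ∀ p ∈ polyLE n m, ∀ q ∈ polyLE n m, L ((π p : MvPolynomial (Fin n) ℝ) * q)
      = L (p * q) := fun p hp q hq => by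
    have := (hπ p hp).2 q hq
    rw [sub_mul, map_sub, sub_eq_zero] at this
    exact this.symm
  have hXB : ∀ i, ∀ b : B, X i * (b : MvPolynomial (Fin n) ℝ) ∈ polyLE n m := fun i b =>
    X_mul_mem_of_mem_polyLT i (hBlt b.2)
  let β : LinearMap.BilinForm ℝ B :=
    ((LinearMap.mul ℝ (MvPolynomial (Fin n) ℝ)).compr₂ L).compl₁₂ B.subtype B.subtype
  have hβ : ∀ x y : B, β x y = L ((x : MvPolynomial (Fin n) ℝ) * y) := fun _ _ => rfl
  have hpos : ∀ x : B, x ≠ 0 → 0 < β x x := by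
    intro x hx
    refine (h x (hBle x.2)).lt_of_ne' fun h0 => hx ?_
    have : (x : MvPolynomial (Fin n) ℝ) ∈ B ⊓ hankelKer L m :=
      ⟨x.2, h.mem_hankelKer (hBle x.2) h0⟩
    rw [hbot] at this
    exact Subtype.ext ((Submodule.mem_bot ℝ).1 this)
  -- Multiplication by the variables on `B ≅ R_m / ker`; joint eigenvalues will be the nodes.
  let T : Fin n → B →ₗ[ℝ] B := fun i =>
    π ∘ₗ LinearMap.mulLeft ℝ (X i : MvPolynomial (Fin n) ℝ) ∘ₗ B.subtype
  have hTapply : ∀ i (b : B), T i b = π (X i * (b : MvPolynomial (Fin n) ℝ)) := fun _ _ => rfl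
  have hT : ∀ i (x y : B), β (T i x) y = L (X i * (x : MvPolynomial (Fin n) ℝ) * (y : MvPolynomial (Fin n) ℝ)) := by
    intro i x y
    rw [hβ, hTapply, hL _ (hXB i x) _ (hBle y.2)]
  have hβsymm : ∀ x y, β x y = β y x := fun x y => by rw [hβ, hβ, mul_comm]
  have hsymm : ∀ i x y, β (T i x) y = β x (T i y) := fun i x y => by
    rw [hβsymm x, hT, hT, mul_right_comm]
  -- Symmetry puts one variable on each side, so the projection is only removed from polynomials of
  -- degree at most `m`. The result is symmetric in `i, j`, whence commutation.
  have hTT : ∀ i j (x y : B), β (T i (T j x)) y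
      = L (X i * X j * (x : MvPolynomial (Fin n) ℝ) * (y : MvPolynomial (Fin n) ℝ)) := fun i j x y => by
    rw [hsymm, hT, mul_comm, hTapply, hL _ (hXB i y) _ (hXB j x)]
    congr 1
    ring
  have hcomm : ∀ i j, Commute (T i) (T j) := by
    intro i j
    refine LinearMap.ext fun x => sub_eq_zero.1 ?_
    by_contra hne
    refine (hpos _ hne).ne' ?_
    rw [Module.End.mul_apply, Module.End.mul_apply, map_sub β, LinearMap.sub_apply, hTT, hTT,
      mul_comm (X i), sub_self]
  obtain ⟨S, u, hx, hu0, hu, horth⟩ :=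
    exists_sum_joint_eigenvectors β hβsymm hpos T hsymm hcomm (π 1)
  -- Decomposing the class of `1` into joint eigenvectors gives `π p = ∑ p(ζ) u_ζ`, by induction on
  -- the degree.
  have hrep : ∀ d ≤ m, polyLE n d ≤ LinearMap.eqLocus π
      (∑ ζ ∈ S, (aeval ζ : MvPolynomial (Fin n) ℝ →ₐ[ℝ] ℝ).toLinearMap.smulRight (u ζ)) := by
    intro d
    induction d with
    | zero =>
      intro _
      exact polyLE_zero_le (by simpa using hx)
    | succ d ih =>
      intro hd
      refine polyLE_succ_le (ih (by omega)) fun i q hq => ?_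
      have hq' : π q = _ := ih (by omega) hq
      have hqm : q ∈ polyLT n m := polyLT_mono hd hq
      -- Kernel stability gives `π (X i * q) = T i (π q)`.
      have hκ := hπK _ (X_mul_mem_hankelKer_of_flat hflat (hπ q (polyLT_le_polyLE m hqm))
        (sub_mem hqm (hBlt (π q).2)) i)
      rw [mul_sub, map_sub, sub_eq_zero, ← hTapply, hq', LinearMap.sum_apply, map_sum] at hκ
      rw [LinearMap.mem_eqLocus, hκ, LinearMap.sum_apply]
      refine Finset.sum_congr rfl fun ζ _ => ?_
      simp [hu, smul_smul, mul_comm]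
  have hrep : ∀ p ∈ polyLE n m, π p = ∑ ζ ∈ S, eval ζ p • u ζ := fun p hp => by
    have : π p = _ := hrep m le_rfl hp
    simpa [LinearMap.sum_apply, aeval_eq_eval] using this
  refine ⟨S, fun ζ => β (u ζ) (u ζ), fun ζ hζ => hpos _ (hu0 ζ hζ), fun p hp => ?_, ?_⟩
  · rw [two_mul] at hp
    refine Submodule.mul_induction_on (polyLE_add_le_mul m m hp) (fun a ha b hb => ?_)
      fun a b ha hb => ?_
    · rw [← hL a ha b hb, mul_comm, ← hL b hb _ (hBle (π a).2), mul_comm, ← hβ, hrep a ha,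
        hrep b hb]
      simp only [map_sum, LinearMap.sum_apply, map_smul, LinearMap.smul_apply, smul_eq_mul, map_mul]
      refine Finset.sum_congr rfl fun ζ hζ => ?_
      rw [Finset.sum_eq_single_of_mem ζ hζ fun ζ' _ hne => by rw [horth _ _ hne]; simp]
      ring
    · simp only [map_add, ha, hb, mul_add, Finset.sum_add_distrib]
  -- The `u_ζ` form a basis of `B`, so the number of nodes is the rank.
  · have hli : LinearIndependent ℝ fun ζ : S => u ζ :=
      LinearMap.linearIndependent_of_isOrthoᵢ (B := β)
        (fun ζ ζ' hne => horth _ _ fun he => hne (Subtype.ext he))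
        fun ζ => (hpos _ (hu0 ζ ζ.2)).ne'
    have hspan : Submodule.span ℝ (Set.range fun ζ : S => u ζ) = ⊤ := by
      refine top_unique fun b _ => ?_
      rw [← hπB b, hrep b (hBle b.2)]
      exact Submodule.sum_mem _ fun ζ hζ =>
        Submodule.smul_mem _ _ (Submodule.subset_span ⟨⟨ζ, hζ⟩, rfl⟩)
    have hcard := finrank_span_eq_card hli
    rw [hspan, finrank_top, Fintype.card_coe] at hcard
    have := Submodule.finrank_sup_add_finrank_inf_eq B (hankelKer L m)
    rw [hbot, hsup, finrank_bot, add_zero, hcard] at this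
    exact this.symm

end Flat

/-! ### Hankel operators versus forms on all polynomials -/

section Bridge

variable {n k : ℕ} {L : MvPolynomial (Fin n) ℝ →ₗ[ℝ] ℝ} {σ : Module.Dual ℝ (polyLE n (2 * k))}

theorem hankel_apply_eq (hL : ∀ p : polyLE n (2 * k), σ p = L p) (p q : polyLE n k) :
    hankel σ p q = L ((p : MvPolynomial (Fin n) ℝ) * (q : MvPolynomial (Fin n) ℝ)) :=
  hL ⟨_, mul_mem_polyLE p q⟩

theorem isPosSemidef_hankel_iff (hL : ∀ p : polyLE n (2 * k), σ p = L p) :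
    (hankel σ).IsPosSemidef ↔ NonnegOnSquares L k := by
  refine ⟨fun h p hp => ?_, fun h => ⟨⟨fun p q => ?_⟩, ⟨fun p => ?_⟩⟩⟩
  · have := h.isNonneg.nonneg ⟨p, hp⟩
    rwa [hankel_apply_eq hL] at this
  · rw [hankel_apply_eq hL, hankel_apply_eq hL, mul_comm]
  · rw [hankel_apply_eq hL]
    exact h p p.2

theorem mem_ker_hankel_iff (hL : ∀ p : polyLE n (2 * k), σ p = L p) (p : polyLE n k) :
    p ∈ LinearMap.ker (hankel σ) ↔ (p : MvPolynomial (Fin n) ℝ) ∈ hankelKer L k := by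
  rw [LinearMap.mem_ker]
  refine ⟨fun h => ⟨p.2, fun q hq => ?_⟩, fun h => LinearMap.ext fun q => ?_⟩
  · rw [← hankel_apply_eq hL p ⟨q, hq⟩, h, LinearMap.zero_apply]
  · rw [hankel_apply_eq hL, h.2 q q.2, LinearMap.zero_apply]

theorem hankelRank_add_finrank_hankelKer (hL : ∀ p : polyLE n (2 * k), σ p = L p) :
    hankelRank (hankel σ) + Module.finrank ℝ (hankelKer L k) = Module.finrank ℝ (polyLE n k) := by
  have hmap : (LinearMap.ker (hankel σ)).map (polyLE n k).subtype = hankelKer L k := by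
    ext p
    constructor
    · rintro ⟨q, hq, rfl⟩
      exact (mem_ker_hankel_iff hL q).1 hq
    · intro hp
      exact ⟨⟨p, hp.1⟩, (mem_ker_hankel_iff hL _).2 hp, rfl⟩
  rw [← hmap, Submodule.finrank_map_subtype_eq]
  exact LinearMap.finrank_range_add_finrank_ker _

/-- The range is spanned by the evaluations at the nodes. -/
theorem hankelRank_le_card {S : Finset (Fin n → ℝ)} {w : (Fin n → ℝ) → ℝ}
    (hσ : ∀ p : polyLE n (2 * k), σ p = ∑ ζ ∈ S, w ζ * eval ζ (p : MvPolynomial (Fin n) ℝ)) :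
    hankelRank (hankel σ) ≤ S.card := by
  classical
  let e : (Fin n → ℝ) → Module.Dual ℝ (polyLE n k) := fun ζ =>
    (aeval ζ : MvPolynomial (Fin n) ℝ →ₐ[ℝ] ℝ).toLinearMap ∘ₗ (polyLE n k).subtype
  have hle : LinearMap.range (hankel σ) ≤ Submodule.span ℝ (S.image e : Set _) := by
    rintro _ ⟨p, rfl⟩
    have : hankel σ p = ∑ ζ ∈ S, (w ζ * eval ζ (p : MvPolynomial (Fin n) ℝ)) • e ζ := by
      refine LinearMap.ext fun q => (hσ _).trans ?_
      simp [LinearMap.sum_apply, e, aeval_eq_eval, mul_assoc]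
    rw [this]
    exact Submodule.sum_mem _ fun ζ hζ => Submodule.smul_mem _ _
      (Submodule.subset_span (Finset.mem_coe.2 (Finset.mem_image_of_mem e hζ)))
  exact (Submodule.finrank_mono hle).trans
    ((finrank_span_finset_le_card _).trans Finset.card_image_le)

end Bridge

/-! ### Stagnation of ranks -/

section Rank

variable {n : ℕ} {L : MvPolynomial (Fin n) ℝ →ₗ[ℝ] ℝ}

/-- If the rank of the Hankel operator is at most `k`, then its truncations stagnate. -/
theorem exists_le_polyLE_le {k r : ℕ}
    (hr : r + Module.finrank ℝ (hankelKer L k) = Module.finrank ℝ (polyLE n k)) (hrk : r ≤ k) :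
    ∃ d ≤ k, polyLE n d ≤ polyLT n d ⊔ hankelKer L k := by
  by_contra! hcon
  have hfin : ∀ d ≤ k + 1, polyLT n d ⊔ hankelKer L k ≤ polyLE n k := fun d hd =>
    sup_le (polyLT_mono (n := n) hd) (hankelKer_le k)
  have key : ∀ d ≤ k + 1, d + Module.finrank ℝ (hankelKer L k)
      ≤ Module.finrank ℝ (polyLT n d ⊔ hankelKer L k : Submodule ℝ _) := by
    intro d
    induction d with
    -- Since `polyLT n 0 = ⊥`, the chain starts at the kernel itself and has `k + 1` steps.
    | zero => intro _; rw [polyLT, bot_sup_eq, zero_add]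
    | succ d ih =>
      intro hd
      have : FiniteDimensional ℝ (polyLT n (d + 1) ⊔ hankelKer L k : Submodule ℝ _) :=
        Submodule.finiteDimensional_of_le (hfin _ hd)
      have hlt : polyLT n d ⊔ hankelKer L k < polyLT n (d + 1) ⊔ hankelKer L k :=
        lt_of_le_not_ge (sup_le_sup_right (polyLT_mono d.le_succ) _) fun hle =>
          hcon d (by omega) (le_sup_left.trans hle)
      have := Submodule.finrank_lt_finrank_of_lt hlt
      have := ih (by omega)
      omega
  have h1 := key (k + 1) le_rfl
  have h2 := Submodule.finrank_mono (hfin (k + 1) le_rfl)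
  omega

/-- Propagation stops at degree `m`: reaching `m + 1` would need kernel stability in the top degree,
which positivity alone does not give. -/
theorem polyLE_le_of_le {d e m : ℕ} (h : NonnegOnSquares L (m + 1)) (hde : d ≤ e) (hem : e ≤ m)
    (hd : polyLE n d ≤ polyLT n d ⊔ hankelKer L (m + 1)) :
    polyLE n e ≤ polyLT n e ⊔ hankelKer L (m + 1) := by
  induction e, hde using Nat.le_induction with
  | base => exact hd
  | succ e _ ih => exact polyLT_flat_succ h (by omega) (ih (by omega))

/-- If the Hankel operator of order `m + 1` is flat at degree `m`, then `L` agrees with a positive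
cubature formula on the polynomials of degree at most `2 m + 1`, whose number of nodes is less than
the rank unless the Hankel operator is flat. -/
theorem exists_cubature_of_flat_pred {m r : ℕ} (h : NonnegOnSquares L (m + 1))
    (hr : r + Module.finrank ℝ (hankelKer L (m + 1)) = Module.finrank ℝ (polyLE n (m + 1)))
    (hflat : polyLE n m ≤ polyLT n m ⊔ hankelKer L (m + 1)) :
    ∃ (S : Finset (Fin n → ℝ)) (w : (Fin n → ℝ) → ℝ), (∀ ζ ∈ S, 0 < w ζ) ∧
      (∀ p ∈ polyLE n (2 * m + 1), L p = ∑ ζ ∈ S, w ζ * eval ζ p) ∧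
      (¬ polyLE n (m + 1) ≤ polyLE n m ⊔ hankelKer L (m + 1) → S.card < r) := by
  have hinf := hankelKer_inf_polyLE h m.le_succ
  have hflat' : polyLE n m ≤ polyLT n m ⊔ hankelKer L m := by
    intro p hp
    obtain ⟨q, hq, κ, hκ, rfl⟩ := Submodule.mem_sup.1 (hflat hp)
    refine Submodule.add_mem_sup hq (hinf.le ⟨hκ, ?_⟩)
    simpa using sub_mem hp (polyLT_le_polyLE m hq)
  obtain ⟨S, w, hw, hS, hcard⟩ := exists_cubature_of_flat (h.mono m.le_succ) hflat'
  -- `L (κ²) = 0` is a sum of nonnegative terms with positive weights.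
  have hzero : ∀ κ ∈ hankelKer L m, ∀ ζ ∈ S, eval ζ κ = 0 := by
    intro κ hκ ζ hζ
    have h0 := hκ.2 κ hκ.1
    rw [hS _ (two_mul m ▸ mul_mem_polyLE_add hκ.1 hκ.1), Finset.sum_eq_zero_iff_of_nonneg] at h0
    · have := (mul_eq_zero.1 (h0 ζ hζ)).resolve_left (hw ζ hζ).ne'
      rwa [map_mul, mul_self_eq_zero] at this
    · intro ζ hζ
      rw [map_mul]
      exact mul_nonneg (hw ζ hζ).le (mul_self_nonneg _)
  have hmul : ∀ p ∈ polyLE n (m + 1), ∀ q ∈ polyLT n m, p * q ∈ polyLE n (2 * m) := by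
    intro p hp q hq
    cases m with
    | zero => rw [(Submodule.mem_bot ℝ).1 hq, mul_zero p]; exact zero_mem _
    | succ m => exact polyLE_mono (by omega) (mul_mem_polyLE_add hp hq)
  refine ⟨S, w, hw, fun p hp => ?_, fun hnot => ?_⟩
  -- On a product of degrees `m + 1` and `m`, the second factor is reduced modulo the kernel to
  -- degree below `m`, which brings the product into degree `2m`.
  · rw [show 2 * m + 1 = m + 1 + m by omega] at hp
    refine Submodule.mul_induction_on (polyLE_add_le_mul _ _ hp) (fun a ha b hb => ?_)
      fun a b ha hb => ?_
    · obtain ⟨q, hq, κ, hκ, rfl⟩ := Submodule.mem_sup.1 (hflat' hb)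
      rw [mul_add, map_add, mul_comm a κ, (h.hankelKer_mono m.le_succ hκ).2 a ha, add_zero,
        hS _ (hmul a ha q hq)]
      refine Finset.sum_congr rfl fun ζ hζ => ?_
      rw [map_add, map_mul (eval ζ) κ, hzero κ hκ ζ hζ, zero_mul, add_zero]
    · simp only [map_add, ha, hb, mul_add, Finset.sum_add_distrib]
  · have hlt : polyLE n m ⊔ hankelKer L (m + 1) < polyLE n (m + 1) :=
      lt_of_le_not_ge (sup_le (polyLE_mono m.le_succ) (hankelKer_le _)) hnot
    -- `S.card` is the codimension of `hankelKer L (m + 1)` in `R_m ⊔ hankelKer L (m + 1)`, a proper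
    -- subspace of `R_{m+1}`.
    have h1 := Submodule.finrank_lt_finrank_of_lt hlt
    have h2 := Submodule.finrank_sup_add_finrank_inf_eq (polyLE n m) (hankelKer L (m + 1))
    rw [inf_comm, hinf] at h2
    omega

end Rank

/-! ### Minimal rank forces flatness -/

theorem monomial_mem_polyLE_spaceDegree {n : ℕ} {A : Finset (Fin n →₀ ℕ)} (α : A) :
    monomial (α : Fin n →₀ ℕ) (1 : ℝ) ∈ polyLE n (spaceDegree (monomialSpace A)) :=
  (mem_restrictTotalDegree _ _ _).2 ((isGreatest_spaceDegree A).2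
    ⟨_, Submodule.subset_span ⟨_, α.2, rfl⟩, rfl⟩)

theorem exists_dual_extension {n k : ℕ} (σ : Module.Dual ℝ (polyLE n (2 * k))) :
    ∃ L : MvPolynomial (Fin n) ℝ →ₗ[ℝ] ℝ, ∀ p : polyLE n (2 * k), σ p = L p := by
  obtain ⟨L, hL⟩ := LinearMap.exists_extend σ
  exact ⟨L, fun p => (LinearMap.congr_fun hL p).symm⟩

/-- A positive semidefinite Hankel operator of minimal rank `r ≤ k` comes from a positive
cubature formula with `r` nodes. -/
theorem isPositiveCubature_of_minimal_rank {n k r : ℕ} {A : Finset (Fin n →₀ ℕ)} {i : A → ℝ}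
    (hk : spaceDegree (monomialSpace A) + 1 ≤ 2 * k) {σ : Module.Dual ℝ (polyLE n (2 * k))}
    (hi : Extends σ i) (hσ : (hankel σ).IsPosSemidef) (hr : hankelRank (hankel σ) = r)
    (hmin : ∀ H ∈ hankelSet k i, r ≤ hankelRank H) (hrk : r ≤ k) : IsPositiveCubature r σ := by
  obtain ⟨L, hL⟩ := exists_dual_extension σ
  have h := (isPosSemidef_hankel_iff hL).1 hσ
  have hrank := hr ▸ hankelRank_add_finrank_hankelKer hL
  have hflat : polyLE n k ≤ polyLT n k ⊔ hankelKer L k := by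
    obtain ⟨d, hdk, hd⟩ := exists_le_polyLE_le hrank hrk
    rcases hdk.eq_or_lt with rfl | hdk
    · exact hd
    obtain ⟨m, rfl⟩ : ∃ m, k = m + 1 := ⟨k - 1, by omega⟩
    obtain ⟨S, w, hw, hS, hlt⟩ := exists_cubature_of_flat_pred h hrank
      (polyLE_le_of_le h (Nat.lt_succ_iff.1 hdk) le_rfl hd)
    by_contra hnot
    let M : MvPolynomial (Fin n) ℝ →ₗ[ℝ] ℝ :=
      ∑ ζ ∈ S, w ζ • (aeval ζ : MvPolynomial (Fin n) ℝ →ₐ[ℝ] ℝ).toLinearMap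
    have hM : ∀ p, M p = ∑ ζ ∈ S, w ζ * eval ζ p := fun p => by
      simp [M, LinearMap.sum_apply, aeval_eq_eval]
    refine (hlt hnot).not_ge ((hmin _ ⟨M ∘ₗ (polyLE n (2 * (m + 1))).subtype, rfl, fun α => ?_,
      (isPosSemidef_hankel_iff fun _ => rfl).2 fun p _ => ?_⟩).trans
      (hankelRank_le_card fun p => hM p))
    · obtain ⟨hα, hαi⟩ := hi α
      refine ⟨hα, ?_⟩
      rw [← hαi, hL]
      -- The bound on `k` enters here: `deg V ≤ 2m + 1 = 2k - 1`.
      exact (hM _).trans (hS _ (polyLE_mono (by omega) (monomial_mem_polyLE_spaceDegree α))).symm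
    · rw [hM]
      refine Finset.sum_nonneg fun ζ hζ => ?_
      rw [map_mul]
      exact mul_nonneg (hw ζ hζ).le (mul_self_nonneg _)
  obtain ⟨S, w, hw, hS, hcard⟩ := exists_cubature_of_flat h hflat
  let e := S.equivFinOfCardEq (show S.card = r by omega)
  refine ⟨fun j => w (e.symm j), fun j => e.symm j, fun j => hw _ (e.symm j).2,
    Subtype.val_injective.comp e.symm.injective, fun p => ?_⟩
  rw [hL, hS p p.2, ← Finset.sum_coe_sort]
  exact (Equiv.sum_comp e.symm fun ζ : S => w ζ * eval (ζ : Fin n → ℝ) _).symm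

/-! ### Faces cut out by kernels -/

section Face

variable {n k : ℕ} {A : Finset (Fin n →₀ ℕ)} {i : A → ℝ}

theorem convex_hankelSet : Convex ℝ (hankelSet k i) := by
  rintro _ ⟨σ, rfl, hσ, hσ0⟩ _ ⟨τ, rfl, hτ, hτ0⟩ a b ha hb hab
  refine ⟨a • σ + b • τ, rfl, fun α => ?_, (hσ0.smul ha).add (hτ0.smul hb)⟩
  obtain ⟨hα, h1⟩ := hσ α
  obtain ⟨_, h2⟩ := hτ α
  refine ⟨hα, ?_⟩
  rw [LinearMap.add_apply, LinearMap.smul_apply, LinearMap.smul_apply, h1, h2, ← add_smul, hab,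
    one_smul]

theorem apply_eq_zero_of_mem_hankelSet {H : LinearMap.BilinForm ℝ (polyLE n k)}
    (hH : H ∈ hankelSet k i) {p : polyLE n k} (hp : H p p = 0) : H p = 0 := by
  obtain ⟨σ, rfl, -, hσ⟩ := hH
  obtain ⟨L, hL⟩ := exists_dual_extension σ
  rw [hankel_apply_eq hL] at hp
  exact (mem_ker_hankel_iff hL p).2
    (((isPosSemidef_hankel_iff hL).1 hσ).mem_hankelKer p.2 hp)

/-- The elements of `ℋ^k(i)` whose kernel contains a given subspace form a face. -/
theorem isFace_le_ker (N : Submodule ℝ (polyLE n k)) :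
    IsFace (hankelSet k i) {H | H ∈ hankelSet k i ∧ N ≤ LinearMap.ker H} := by
  refine ⟨fun x hx y hy a b ha hb hab => ⟨convex_hankelSet hx.1 hy.1 ha hb hab, fun p hp => ?_⟩,
    fun _ h => h.1, ?_⟩
  · rw [LinearMap.mem_ker, LinearMap.add_apply, LinearMap.smul_apply, LinearMap.smul_apply,
      LinearMap.mem_ker.1 (hx.2 hp), LinearMap.mem_ker.1 (hy.2 hp), smul_zero, smul_zero, add_zero]
  · rintro x hx y hy _ ⟨-, hz⟩ ⟨a, b, ha, hb, -, rfl⟩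
    -- At `p`, two nonnegative values have a vanishing positive combination, so `x p p = 0`, and
    -- semidefiniteness gives `x p = 0`.
    refine ⟨hx, fun p hp => apply_eq_zero_of_mem_hankelSet hx ?_⟩
    have h0 := LinearMap.congr_fun (LinearMap.mem_ker.1 (hz hp)) p
    have hnonneg : ∀ H ∈ hankelSet k i, 0 ≤ H p p := by
      rintro _ ⟨σ, rfl, -, hσ⟩
      exact hσ.isNonneg.nonneg p
    have h1 := hnonneg x hx
    have h2 := mul_nonneg hb.le (hnonneg y hy)
    simp only [LinearMap.add_apply, LinearMap.smul_apply, smul_eq_mul, LinearMap.zero_apply] at h0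
    exact le_antisymm (nonpos_of_mul_nonpos_right (by linarith) ha) h1

end Face

end Cubature

/-! ### The proposition -/

theorem mainTheorem3 (n k r : ℕ) (A : Finset (Fin n →₀ ℕ)) (i : A → ℝ)
    (hk : ((Cubature.spaceDegree (Cubature.monomialSpace A) : ℝ) + 1) / 2 ≤ (k : ℝ))
    (H : LinearMap.BilinForm ℝ (Cubature.polyLE n k))
    (hH : H ∈ Cubature.hankelSet k i)
    (hr : Cubature.hankelRank H = r)
    (hmin : ∀ H' ∈ Cubature.hankelSet k i, Cubature.hankelRank H ≤ Cubature.hankelRank H')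
    (hrk : r ≤ k) :
    H ∈ Cubature.cubatureSet k r i ∧
      (H ∈ (Cubature.hankelSet k i).extremePoints ℝ ∨
        ∃ F : Set (LinearMap.BilinForm ℝ (Cubature.polyLE n k)),
          Cubature.IsFace (Cubature.hankelSet k i) F ∧ H ∈ F ∧
            F ⊆ Cubature.cubatureSet k r i) := by
  have hk' : Cubature.spaceDegree (Cubature.monomialSpace A) + 1 ≤ 2 * k := by
    rw [div_le_iff₀ two_pos, mul_comm] at hk
    exact_mod_cast hk
  rw [hr] at hmin
  have key : ∀ H' ∈ Cubature.hankelSet k i, Cubature.hankelRank H' = r →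
      H' ∈ Cubature.cubatureSet k r i := by
    rintro _ ⟨σ, rfl, hσ, hσ0⟩ hσr
    exact ⟨⟨σ, rfl, hσ, hσ0⟩, σ, rfl,
      Cubature.isPositiveCubature_of_minimal_rank hk' hσ hσ0 hσr hmin hrk⟩
  -- The face alternative always holds; an extreme point needs no separate treatment.
  refine ⟨key H hH hr, Or.inr ⟨_, Cubature.isFace_le_ker (LinearMap.ker H), ⟨hH, le_rfl⟩, ?_⟩⟩
  rintro H' ⟨hH', hker⟩
  refine key H' hH' (le_antisymm ?_ (hmin H' hH'))
  have h1 := LinearMap.finrank_range_add_finrank_ker H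
  have h2 := LinearMap.finrank_range_add_finrank_ker H'
  have h3 := Submodule.finrank_mono hker
  unfold Cubature.hankelRank at hr ⊢
  omega
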